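/- For a field $K$ and $c \in K$ let $f_c(z) = z^2 + c$, and let $G(f_c,K)$ be the directed graph whose vertices are the elements $\alpha \in K$ that are preperiodic for $f_c$ (that is, $f_c^{m+n}(\alpha) = f_c^{n}(\alpha)$ for some $m \ge 1$, $n \ge 0$; the fixed point at infinity is excluded), with an edge from $\alpha$ to $\beta$ if and only if $f_c(\alpha) = \beta$. Let $G_5$ be the directed graph with the twelve vertices $\alpha_i, \alpha_i', p_i, p_i'$ ($i = 1,2$) and $\beta_i, \beta_i'$ ($i=1,2$) and with the twelve edges $$\alpha_i \to p_i', \quad \alpha_i' \to p_i', \quad p_i' \to p_i, \quad p_i \to p_i \quad (i = 1,2), \qquad \beta_1 \to \beta_2,\quad \beta_1' \to \beta_2,\quad \beta_2 \to \beta_1,\quad \beta_2' \to \beta_1.$$ (So $\alpha_1,\alpha_2$ have eventual period $1$ and preperiod $2$, i.e. type $1_2$, and have disjoint orbits, $\beta_1$ has period $2$, and $G_5$ is generated by $\alpha_1,\alpha_2,\beta_1$ as a graph in which every vertex has out-degree $1$ and in-degree $0$ or $2$.) Let $Y$ be the affine curve in $\mathbb{A}^3$ over $\mathbb{Q}$ defined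 by $$y^2 = (5x^2-1)(x^2+3), \qquad z^2 = -(3x^2+1)(x^2-5),$$ and let $Y(\mathbb{Q},2)$ be the set of points $P \in Y(\overline{\mathbb{Q}})$ whose coordinates generate a field $\mathbb{Q}(P)$ with $[\mathbb{Q}(P):\mathbb{Q}] \le 2$. Theorem. (1) Let $K$ be a quadratic field, that is, an extension of $\mathbb{Q}$ of degree $2$, and let $c \in K$. Then $G(f_c,K)$ does not contain a subgraph isomorphic to $G_5$. (2) $Y(\mathbb{Q},2) = Y(\mathbb{Q}) = \{(\pm 1, \pm 4, \pm 4)\}$, where the three signs are independent; in particular $Y(\mathbb{Q})$ has exactly $8$ elements. -/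

import Mathlib

namespace QuadraticDynamics

/-- The quadratic polynomial map `f_c(z) = z² + c` on `K`. -/
def quadMap {K : Type*} [Field K] (c : K) : K → K := fun z => z ^ 2 + c

/-- `a` is preperiodic for `φ`: `φ^(m+n)(a) = φ^n(a)` for some `m ≥ 1` and `n ≥ 0`. -/
def IsPreperiodic {S : Type*} (φ : S → S) (a : S) : Prop :=
  ∃ m n : ℕ, 1 ≤ m ∧ φ^[m + n] a = φ^[n] a

/-- The preperiodic graph of a polynomial map `φ` on `K`: the vertices are the (finite)
`K`-rational preperiodic points, with an edge from `a` to `b` exactly when `φ(a) = b`.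
The fixed point at infinity is excluded. -/
def preperGraph {K : Type*} (φ : K → K) : Digraph {a : K // IsPreperiodic φ a} where
  Adj a b := φ a = b

/-- `G` contains a subgraph isomorphic to `H`. -/
def ContainsCopy {V W : Type*} (G : Digraph V) (H : Digraph W) : Prop :=
  ∃ i : W → V, Function.Injective i ∧ ∀ a b : W, H.Adj a b → G.Adj (i a) (i b)

/-- The twelve vertices of the graph `G₅`. The name `nv` stands for the other preimage of the
image of `v` (the vertex that becomes `-v` in a graph `G(f_c, K)`). -/
inductive G5Vertex
  /-- the two points of type `1₂`, with disjoint orbits -/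
  | α₁ | α₂
  /-- the vertices having the same images as `α₁`, `α₂` -/
  | nα₁ | nα₂
  /-- the fixed points in the orbits of `α₁`, `α₂` -/
  | p₁ | p₂
  /-- the points of type `1₁` mapping to `p₁`, `p₂` -/
  | np₁ | np₂
  /-- the 2-cycle -/
  | β | β'
  /-- the points of type `2₁` having the same images as `β`, `β'` -/
  | nβ | nβ'

/-- The unique out-neighbour of each vertex of `G₅`. -/
def G5Vertex.next : G5Vertex → G5Vertex
  | .α₁ => .np₁
  | .nα₁ => .np₁
  | .np₁ => .p₁
  | .p₁ => .p₁
  | .α₂ => .np₂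
  | .nα₂ => .np₂
  | .np₂ => .p₂
  | .p₂ => .p₂
  | .β => .β'
  | .nβ => .β'
  | .β' => .β
  | .nβ' => .β

/-- The graph `G₅`: the admissible graph (each vertex has out-degree 1 and in-degree 0 or 2)
generated by two points `α₁`, `α₂` of type `1₂` with disjoint orbits and a point `β`
of period 2. -/
def G5 : Digraph G5Vertex where
  Adj a b := a.next = b

/-- The `F`-points of the affine curve
`Y : y² = (5x² - 1)(x² + 3), z² = -(3x² + 1)(x² - 5)` in 3-space, with `(x, y, z)` written
as `(P 0, P 1, P 2)`. -/
def curveY (F : Type*) [Field F] : Set (Fin 3 → F) :=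
  {P | P 1 ^ 2 = (5 * P 0 ^ 2 - 1) * (P 0 ^ 2 + 3) ∧
       P 2 ^ 2 = -(3 * P 0 ^ 2 + 1) * (P 0 ^ 2 - 5)}

/-- The set `X(k, 2)` of the points of an affine variety `X`, given by its set of points over
the algebraic closure of `k`, that are rational or quadratic over `k`: the field of definition
`k(P)`, generated over `k` by the coordinates of `P`, has degree at most 2. -/
def ratOrQuadPoints (k : Type*) [Field k] {n : ℕ} (X : Set (Fin n → AlgebraicClosure k)) :
    Set (Fin n → AlgebraicClosure k) :=
  {P | P ∈ X ∧ Module.finrank k (IntermediateField.adjoin k (Set.range P)) ≤ 2}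

end QuadraticDynamics

/-!
Why the theorem is true. Put `r = 2(x² + 1)/(x² - 1)`. A point `(x, y, z)` of `Y` with `x² ≠ 1`
makes the three numbers `r² - 4`, `(r - 1)² - 4`, `(r + 1)² - 4` squares, and so does a copy of `G₅`
in `G(f_c, K)`, with `r = p₁ - p₂` the difference of the two fixed points: the square roots are
`β - β'`, `2α₁`, `2α₂`. Both halves of the theorem therefore follow from
`no_three_square_neighbours`: in a field `K` of degree at most 2 over `ℚ` there is no `r` for which
these three numbers are squares. Points of `Y` with `x² = 1` have `y² = z² = 16`.

Rational `r`. Of three square roots in `K` of rational numbers, two have a rational product, so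
one of the products of two of the three numbers is a rational square. This puts `r` on a curve of
genus one of rank zero, either `w² = (r² - 4)((r + 1)² - 4)` (up to `r ↦ -r`) or
`w² = (r² - 1)(r² - 9)`. The rational points of both come from the single statement `quartic_rat`:
for `n = 3` and `n = 9`, `w² = (t² - 1)(t² - n²)` forces `t = 0` or `w = 0`; the first curve is
sent to the case `n = 9` by an isogeny. The statement is proved by Fermat's infinite descent
(`descent`) on `P² - e² = Q²`, `P² - n² e² = R²`: the two Pythagorean triples with hypotenuse `P`
yield a factorization `e = 2ABCD` and a solution of the same system, up to a twist `g ∣ n² - 1`.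
Each possible twist is removed by a translation by a point of order at most 2, after which the new `e` is one
of `A, B, C, D` (`exists_smaller_leg`).

Irrational `r`. Let `a² = r² - 4`, `c² = (r + 1)² - 4`. Then `s = r - a` satisfies
`(2sc)² = (s² + 6s + 4)(s² - 2s + 4)`, and `2sc = s² + ps + q` with `p, q ∈ ℚ`. The parabola meets
this quartic curve in `s`, in its conjugate, and in one further point, which is rational. Since the
only rational points of the curve are at infinity or over `s = 0`, one obtains that `c - a` or
`c + a` is rational (`add_or_sub_rational`). The same holds for `b² = (r - 1)² - 4` and `a`, and the
two conclusions together force `a = ±r`, which is absurd.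
-/

namespace QuadraticDynamics

/-! ### Twists of a pair of concordant forms -/

/-- If `(B : C)` solves the `g`-twist of the system `P² - e² = □`, `P² - n² e² = □`, and `g` is, up to
squares, one of `±1`, `±(n² - 1)`, then the untwisted system has a solution with `e` among
`A, B, C, D`. With `X = B² / C²` this is translation by a point of order at most 2 on
`Y² = X (X - 1) (X - n²)`. -/
theorem exists_smaller_leg {n g A B C D : ℤ} (hg0 : g ≠ 0)
    (h1 : B ^ 2 - C ^ 2 = g * A ^ 2) (h2 : B ^ 2 - n ^ 2 * C ^ 2 = g * D ^ 2)
    (hg : ∃ k : ℤ, g = k ^ 2 ∨ g = -k ^ 2 ∨ g * k ^ 2 = n ^ 2 - 1 ∨ g * k ^ 2 = -(n ^ 2 - 1)) :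
    ∃ e P Q R : ℤ, (e = A ∨ e = B ∨ e = C ∨ e = D) ∧
      P ^ 2 - e ^ 2 = Q ^ 2 ∧ P ^ 2 - n ^ 2 * e ^ 2 = R ^ 2 := by
  obtain ⟨k, hk | hk | hk | hk⟩ := hg
  · exact ⟨C, B, k * A, k * D, by simp, by rw [h1, hk]; ring, by rw [h2, hk]; ring⟩
  · subst hk
    exact ⟨B, n * C, k * D, n * (k * A), by simp, by linear_combination -h2,
      by linear_combination -n ^ 2 * h1⟩
  · have h3 : A ^ 2 - D ^ 2 = (k * C) ^ 2 :=
      mul_left_cancel₀ hg0 (by linear_combination h2 - h1 - C ^ 2 * hk)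
    refine ⟨D, n * A, k * B, n * (k * C), by simp, ?_, by linear_combination n ^ 2 * h3⟩
    linear_combination h3 - k ^ 2 * h1 - A ^ 2 * hk
  · have h3 : D ^ 2 - A ^ 2 = (k * C) ^ 2 :=
      mul_left_cancel₀ hg0 (by linear_combination h1 - h2 - C ^ 2 * hk)
    refine ⟨A, D, k * C, k * B, by simp, h3, ?_⟩
    linear_combination h3 - k ^ 2 * h1 - A ^ 2 * hk

theorem twist_dvd {n g A B C D : ℤ} (hBC : IsCoprime B C)
    (h1 : B ^ 2 - C ^ 2 = g * A ^ 2) (h2 : B ^ 2 - n ^ 2 * C ^ 2 = g * D ^ 2) :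
    g ∣ n ^ 2 - 1 := by
  obtain ⟨x, y, hxy⟩ := (hBC.pow (m := 2) (n := 2))
  refine ⟨x * (n ^ 2 * A ^ 2 - D ^ 2) + y * (A ^ 2 - D ^ 2), ?_⟩
  linear_combination (-(n ^ 2 - 1)) * hxy + (x * n ^ 2 + y) * h1 - (x + y) * h2

/-- A twist by `g` with coprime solutions only occurs when `g` is, up to squares, one of `±1`,
`±(n² - 1)`. For `n = 3` this is clear from `g ∣ 8`; for `n = 9` the divisors `±2, ±8, ±10, ±40` of
`80` have to be excluded, which is done modulo powers of 2. -/
theorem twist_class {n g A B C D : ℤ} (hn : n = 3 ∨ n = 9) (hBC : IsCoprime B C)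
    (hAD : IsCoprime A D)
    (h1 : B ^ 2 - C ^ 2 = g * A ^ 2) (h2 : B ^ 2 - n ^ 2 * C ^ 2 = g * D ^ 2) :
    ∃ k : ℤ, g = k ^ 2 ∨ g = -k ^ 2 ∨ g * k ^ 2 = n ^ 2 - 1 ∨ g * k ^ 2 = -(n ^ 2 - 1) := by
  have hd := twist_dvd hBC h1 h2
  -- for even `g` the coprime integers `B`, `C` have the same parity, so both are odd
  have hodd : Even g → Odd B ∧ Odd C := by
    intro hg
    have : Even (B ^ 2 - C ^ 2) := by rw [h1]; exact hg.mul_right _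
    have hs : Even B ↔ Even C := by
      simpa [Int.even_sub, Int.even_pow] using this
    rcases Int.even_or_odd B with hB | hB
    · exact absurd (hBC.isUnit_of_dvd' hB.two_dvd (hs.1 hB).two_dvd) (by decide)
    · exact ⟨hB, Int.not_even_iff_odd.1 fun h => Int.not_even_iff_odd.2 hB (hs.2 h)⟩
  have hAD2 : ¬ (Even A ∧ Even D) := fun h =>
    absurd (hAD.isUnit_of_dvd' h.1.two_dvd h.2.two_dvd) (by decide)
  have ev2 : ∀ x : ℤ, 4 ∣ x ^ 2 → Even x := by
    intro x hx
    rcases Int.even_or_odd x with h | h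
    · exact h
    · have := Int.sq_mod_four_eq_one_of_odd h
      omega
  have diff4 : ∀ x y : ℤ, (x ^ 2 - y ^ 2) % 4 ≠ 2 := by
    intro x y
    rcases Int.even_or_odd x with hx | hx <;> rcases Int.even_or_odd y with hy | hy
    all_goals
      first
      | have hx' := Int.sq_mod_four_eq_one_of_odd hx
      | (obtain ⟨x', rfl⟩ := hx
         have hx' : (x' + x') ^ 2 % 4 = 0 := by ring_nf; omega)
      first
      | have hy' := Int.sq_mod_four_eq_one_of_odd hy
      | (obtain ⟨y', rfl⟩ := hy
         have hy' : (y' + y') ^ 2 % 4 = 0 := by ring_nf; omega)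
      omega
  rcases hn with rfl | rfl
  · have hb : g ∣ 8 := by simpa using hd
    have hle := Int.le_of_dvd (by norm_num) hb
    have hge := Int.le_of_dvd (by norm_num) (neg_dvd.2 hb)
    have hge' : -8 ≤ g := by omega
    interval_cases g <;> first
      | (exfalso; revert hb; decide)
      | (refine ⟨1, ?_⟩; decide)
      | (refine ⟨2, ?_⟩; decide)
  -- for the excluded `g` either `A² - D² ≡ 2` modulo 4, or `A` and `D` are both even
  · have hb : g ∣ 80 := by simpa using hd
    have hle := Int.le_of_dvd (by norm_num) hb
    have hge := Int.le_of_dvd (by norm_num) (neg_dvd.2 hb)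
    have hge' : -80 ≤ g := by omega
    have hsq : Even g → B ^ 2 % 8 = 1 ∧ C ^ 2 % 8 = 1 := fun h => by
      have hB := Int.eight_dvd_sq_sub_one_of_odd (hodd h).1
      have hC := Int.eight_dvd_sq_sub_one_of_odd (hodd h).2
      omega
    have hA := ev2 A
    have hD := ev2 D
    have hdiff := diff4 A D
    interval_cases g <;> first
      | (exfalso; revert hb; decide)
      | (refine ⟨1, ?_⟩; decide)
      | (refine ⟨2, ?_⟩; decide)
      | (refine ⟨4, ?_⟩; decide)
      | (exfalso
         obtain ⟨hB8, hC8⟩ := hsq (by decide)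
         first
         | omega
         | exact hAD2 ⟨hA (by omega), hD (by omega)⟩)

/-! ### Infinite descent on `P² - e² = □`, `P² - n² e² = □` -/

/-- The descent step. The integers `u, v` and `s, t` parametrize two Pythagorean triples with the same
hypotenuse and with legs `2uv` and `2st = n · 2uv`. -/
theorem exists_smaller_of_parameters {n u v s t : ℤ} (hn : n = 3 ∨ n = 9) (huv : IsCoprime u v)
    (hst : IsCoprime s t) (hns : n ∣ s) (hsum : u ^ 2 + v ^ 2 = s ^ 2 + t ^ 2)
    (hprod : s * t = n * (u * v)) (hne : u * v ≠ 0) :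
    ∃ e P Q R : ℤ, e ≠ 0 ∧ e ∣ u * v ∧ P ^ 2 - e ^ 2 = Q ^ 2 ∧ P ^ 2 - n ^ 2 * e ^ 2 = R ^ 2 := by
  have hn0 : n ≠ 0 := by rcases hn with rfl | rfl <;> norm_num
  obtain ⟨s, rfl⟩ := hns
  have hprod' : s * t = u * v := mul_left_cancel₀ hn0 (by linear_combination hprod)
  have hu : u ≠ 0 := left_ne_zero_of_mul hne
  -- four-number lemma: `s t = u v` gives `u = AB`, `s = AC`, `t = BD`, `v = CD`
  obtain ⟨A, B, C, hA, hBC, rfl, rfl⟩ :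
      ∃ A B C : ℤ, A ≠ 0 ∧ IsCoprime B C ∧ u = B * A ∧ s = C * A := by
    have hpos : 0 < Int.gcd u s := Int.gcd_pos_of_ne_zero_left s hu
    obtain ⟨B, C, h, h1, h2⟩ := Int.exists_gcd_one hpos
    exact ⟨_, B, C, by exact_mod_cast hpos.ne', Int.isCoprime_iff_gcd_eq_one.2 h, h1, h2⟩
  have h4 : C * t = B * v := mul_left_cancel₀ hA (by linear_combination hprod')
  obtain ⟨D, rfl⟩ : B ∣ t := hBC.dvd_of_dvd_mul_left ⟨v, h4⟩
  have hB : B ≠ 0 := left_ne_zero_of_mul hu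
  obtain rfl : v = C * D := mul_left_cancel₀ hB (by linear_combination -h4)
  have hAD : IsCoprime A D :=
    (huv.of_isCoprime_of_dvd_left (Dvd.intro_left _ rfl)).of_isCoprime_of_dvd_right
      (Dvd.intro_left _ rfl)
  have hquad : A ^ 2 * (B ^ 2 - n ^ 2 * C ^ 2) = D ^ 2 * (B ^ 2 - C ^ 2) := by
    linear_combination hsum
  obtain ⟨g, hg⟩ : A ^ 2 ∣ B ^ 2 - C ^ 2 :=
    (hAD.pow (m := 2) (n := 2)).dvd_of_dvd_mul_left ⟨_, hquad.symm⟩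
  have h1 : B ^ 2 - C ^ 2 = g * A ^ 2 := by rw [hg]; ring
  have h2 : B ^ 2 - n ^ 2 * C ^ 2 = g * D ^ 2 :=
    mul_left_cancel₀ (pow_ne_zero 2 hA) (by rw [hquad, h1]; ring)
  have hC : C ≠ 0 := fun h => hne (by rw [h]; ring)
  have hD : D ≠ 0 := fun h => hne (by rw [h]; ring)
  have hg0 : g ≠ 0 := by
    rintro rfl
    have : (n ^ 2 - 1) * C ^ 2 = 0 := by linear_combination h1 - h2
    rcases hn with rfl | rfl <;> simp_all
  obtain ⟨e, P, Q, R, he, h⟩ := exists_smaller_leg hg0 h1 h2 (twist_class hn hBC hAD h1 h2)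
  refine ⟨e, P, Q, R, ?_, ?_, h⟩
  · rcases he with rfl | rfl | rfl | rfl <;> assumption
  · rcases he with rfl | rfl | rfl | rfl
    exacts [⟨B * (C * D), by ring⟩, ⟨A * (C * D), by ring⟩, ⟨B * A * D, by ring⟩,
      ⟨B * A * C, by ring⟩]

/-- A power of 3 that divides a product of coprime integers divides one of the factors. -/
theorem three_power_dvd_or {n s t : ℤ} (hn : n = 3 ∨ n = 9) (hst : IsCoprime s t)
    (h : n ∣ s * t) : n ∣ s ∨ n ∣ t := by
  have h3 : ∀ x : ℤ, ¬ 3 ∣ x → IsCoprime n x := fun x hx => by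
    have : IsCoprime (3 : ℤ) x := (Int.prime_three.coprime_iff_not_dvd).2 hx
    rcases hn with rfl | rfl
    · exact this
    · simpa using this.pow_left (m := 2)
  by_cases hs : (3 : ℤ) ∣ s
  · refine .inl ((h3 t fun ht => ?_).dvd_of_dvd_mul_right h)
    exact absurd (hst.isUnit_of_dvd' hs ht) (by decide)
  · exact .inr ((h3 s hs).dvd_of_dvd_mul_left h)

/-- The hypotenuse of a primitive Pythagorean triple is prime to 3. -/
theorem coprime_three_power_of_sum_sq {n e P Q : ℤ} (hn : n = 3 ∨ n = 9) (hco : IsCoprime P e)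
    (h1 : P ^ 2 - e ^ 2 = Q ^ 2) : IsCoprime P n := by
  have hP3 : ¬ (3 : ℤ) ∣ P := by
    intro h
    have he : ¬ (3 : ℤ) ∣ e := fun h' => absurd (hco.isUnit_of_dvd' h h') (by decide)
    have hsq : ∀ x : ℤ, x ^ 2 % 3 = 0 ∧ x % 3 = 0 ∨ x ^ 2 % 3 = 1 ∧ x % 3 ≠ 0 := by
      intro x
      rcases (by omega : x % 3 = 0 ∨ x % 3 = 1 ∨ x % 3 = 2) with h | h | h <;>
        simp [pow_two, Int.mul_emod, h]
    have := hsq P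
    have := hsq e
    have := hsq Q
    omega
  have : IsCoprime P 3 := ((Int.prime_three.coprime_iff_not_dvd).2 hP3).symm
  rcases hn with rfl | rfl
  · exact this
  · simpa using this.pow_right (n := 2)

theorem isCoprime_legs {P x y : ℤ} (hco : IsCoprime P y) (h : P ^ 2 - y ^ 2 = x ^ 2) :
    IsCoprime x y := by
  have : IsCoprime (P ^ 2 + y * (-y)) y := (hco.pow_left (m := 2)).add_mul_left_left _
  rw [show P ^ 2 + y * (-y) = x ^ 2 by rw [← h]; ring] at this
  exact (IsCoprime.pow_left_iff two_pos).1 this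

/-- Pythagorean triples in parameters, for a hypotenuse of either sign. -/
theorem exists_parameters {P x y : ℤ} (hP : P ≠ 0) (hco : IsCoprime x y) (hx : x % 2 = 1)
    (h : P ^ 2 = x ^ 2 + y ^ 2) :
    ∃ u v : ℤ, x = u ^ 2 - v ^ 2 ∧ y = 2 * u * v ∧ |P| = u ^ 2 + v ^ 2 ∧ IsCoprime u v ∧
      (u % 2 = 0 ∧ v % 2 = 1 ∨ u % 2 = 1 ∧ v % 2 = 0) := by
  obtain ⟨u, v, h1, h2, h3, h4, h5, -⟩ := PythagoreanTriple.coprime_classification'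
    (x := x) (y := y) (z := |P|)
    (show x * x + y * y = |P| * |P| by rw [abs_mul_abs_self]; linear_combination -h)
    (Int.isCoprime_iff_gcd_eq_one.1 hco) hx (abs_pos.2 hP)
  exact ⟨u, v, h1, h2, h3, Int.isCoprime_iff_gcd_eq_one.2 h4, h5⟩

/-- If `e` is odd, both triples have `e`, `n e` as their odd legs `u² - v²`, `s² - t²`; then `s²` and
`t²` are binary quadratic forms in `u, v` that are not both squares modulo 8. -/
theorem even_leg {n e P Q R : ℤ} (hn : n = 3 ∨ n = 9) (hP : P ≠ 0) (hco : IsCoprime P e)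
    (h1 : P ^ 2 - e ^ 2 = Q ^ 2) (h2 : P ^ 2 - n ^ 2 * e ^ 2 = R ^ 2) : Even e := by
  by_contra he
  have he2 : e % 2 = 1 := by rw [Int.even_iff] at he; omega
  have hn2 : (n * e) % 2 = 1 := by rcases hn with rfl | rfl <;> omega
  obtain ⟨u, v, hu, -, hPu, -, hpar⟩ := exists_parameters hP (isCoprime_legs hco h1).symm he2
    (by linear_combination h1)
  obtain ⟨s, t, hs, -, hPs, -, -⟩ := exists_parameters (y := R) hP
    (isCoprime_legs ((coprime_three_power_of_sum_sq hn hco h1).mul_right hco)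
      (by rw [← h2]; ring)).symm hn2 (by linear_combination h2)
  have hodd : ∀ x : ℤ, x % 2 = 1 → x ^ 2 % 8 = 1 := fun x hx => by
    have := Int.eight_dvd_sq_sub_one_of_odd (Int.odd_iff.2 hx)
    omega
  have heven : ∀ x : ℤ, x % 2 = 0 → x ^ 2 % 4 = 0 := fun x hx => by
    obtain ⟨y, rfl⟩ := Int.dvd_of_emod_eq_zero hx
    rw [mul_pow]
    omega
  have hs' := hodd s
  have ht' := hodd t
  have hs'' := heven s
  have ht'' := heven t
  have := Int.emod_two_eq_zero_or_one s
  have := Int.emod_two_eq_zero_or_one t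
  rw [hu] at hs
  rcases hpar with ⟨hu2, hv2⟩ | ⟨hu2, hv2⟩
  · have := heven u hu2
    have := hodd v hv2
    rcases hn with rfl | rfl <;> omega
  · have := hodd u hu2
    have := heven v hv2
    rcases hn with rfl | rfl <;> omega

/-- The system `P² - e² = Q²`, `P² - n² e² = R²` has only the solutions with `e = 0`, for `n = 3` and
`n = 9`. -/
theorem descent {n : ℤ} (hn : n = 3 ∨ n = 9) (e P Q R : ℤ)
    (h1 : P ^ 2 - e ^ 2 = Q ^ 2) (h2 : P ^ 2 - n ^ 2 * e ^ 2 = R ^ 2) : e = 0 := by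
  induction h : e.natAbs using Nat.strong_induction_on generalizing e P Q R with
  | _ N ih =>
  subst h
  by_contra he
  have hpos : 0 < Int.gcd P e := Int.gcd_pos_of_ne_zero_right P he
  obtain ⟨P', e', hco, hP, he'⟩ := Int.exists_gcd_one hpos
  set d : ℤ := (Int.gcd P e : ℤ) with hd
  have hd0 : d ≠ 0 := by rw [hd]; exact_mod_cast hpos.ne'
  have he'0 : e' ≠ 0 := fun h => he (by rw [he', h]; ring)
  -- a common factor of `P` and `e` can be divided out, which makes `e` smaller
  by_cases hd1 : Int.gcd P e = 1
  swap
  · obtain ⟨Q', rfl⟩ : d ∣ Q := (Int.pow_dvd_pow_iff two_ne_zero).1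
      ⟨P' ^ 2 - e' ^ 2, by rw [← h1, hP, he']; ring⟩
    obtain ⟨R', rfl⟩ : d ∣ R := (Int.pow_dvd_pow_iff two_ne_zero).1
      ⟨P' ^ 2 - n ^ 2 * e' ^ 2, by rw [← h2, hP, he']; ring⟩
    refine he'0 (ih _ ?_ e' P' Q' R' ?_ ?_ rfl)
    · have h2d : 2 ≤ d.natAbs := by rw [hd, Int.natAbs_natCast]; omega
      rw [he', Int.natAbs_mul]
      nlinarith [Int.natAbs_pos.2 he'0]
    · exact mul_left_cancel₀ (pow_ne_zero 2 hd0) (by rw [hP, he'] at h1; linear_combination h1)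
    · exact mul_left_cancel₀ (pow_ne_zero 2 hd0) (by rw [hP, he'] at h2; linear_combination h2)
  have hcop : IsCoprime P e := Int.isCoprime_iff_gcd_eq_one.2 hd1
  have hP0 : P ≠ 0 := by
    rintro rfl
    nlinarith [sq_nonneg Q, pow_pos (abs_pos.2 he) 2, sq_abs e]
  have heven := even_leg hn hP0 hcop h1 h2
  have hPodd : Odd P := by
    rw [← Int.not_even_iff_odd]
    intro h
    exact absurd (hcop.isUnit_of_dvd' h.two_dvd heven.two_dvd) (by decide)
  have hQ : Q % 2 = 1 := by
    have := hPodd.pow (n := 2)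
    rw [show P ^ 2 = Q ^ 2 + e ^ 2 by linear_combination h1, Int.odd_add] at this
    exact Int.odd_iff.1 ((Int.odd_pow' two_ne_zero).1 (this.2 (heven.pow_of_ne_zero two_ne_zero)))
  have hR : R % 2 = 1 := by
    have := hPodd.pow (n := 2)
    rw [show P ^ 2 = R ^ 2 + (n * e) ^ 2 by linear_combination h2, Int.odd_add] at this
    exact Int.odd_iff.1 ((Int.odd_pow' two_ne_zero).1
      (this.2 ((heven.mul_left n).pow_of_ne_zero two_ne_zero)))
  obtain ⟨u, v, -, huv, hPuv, hcuv, -⟩ := exists_parameters hP0 (isCoprime_legs hcop h1) hQ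
    (by linear_combination h1)
  obtain ⟨s, t, -, hst, hPst, hcst, -⟩ := exists_parameters (y := n * e) hP0
    (isCoprime_legs ((coprime_three_power_of_sum_sq hn hcop h1).mul_right hcop)
      (by rw [← h2]; ring)) hR (by linear_combination h2)
  have hprod : s * t = n * (u * v) := by
    rw [huv] at hst
    linarith
  have hne : u * v ≠ 0 := fun h => he (by rw [huv, mul_assoc, h, mul_zero])
  have hsum : u ^ 2 + v ^ 2 = s ^ 2 + t ^ 2 := hPuv.symm.trans hPst
  obtain ⟨e₁, P₁, Q₁, R₁, he₁, hdvd, h₁, h₂⟩ : ∃ e P Q R : ℤ, e ≠ 0 ∧ e ∣ u * v ∧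
      P ^ 2 - e ^ 2 = Q ^ 2 ∧ P ^ 2 - n ^ 2 * e ^ 2 = R ^ 2 := by
    rcases three_power_dvd_or hn hcst ⟨_, hprod⟩ with hns | hnt
    · exact exists_smaller_of_parameters hn hcuv hcst hns hsum hprod hne
    · exact exists_smaller_of_parameters hn hcuv hcst.symm hnt (by rw [hsum]; ring)
        (by rw [← hprod]; ring) hne
  refine he₁ (ih _ ?_ e₁ P₁ Q₁ R₁ h₁ h₂ rfl)
  have hle := Int.natAbs_le_of_dvd_ne_zero hdvd hne
  have hpos' := Int.natAbs_pos.2 hne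
  have : e.natAbs = 2 * (u * v).natAbs := by rw [huv, mul_assoc, Int.natAbs_mul]; rfl
  omega

/-! ### Rational points on curves of genus one -/

/-- The two factors of the square are `g A²` and `g D²` with coprime `A, D`, so `(P : e)` solves the
`g`-twist of the system in `descent`. -/
theorem quartic_int {n : ℤ} (hn : n = 3 ∨ n = 9) {P e W : ℤ} (hco : IsCoprime P e)
    (hP : P ≠ 0) (he : e ≠ 0) (hW : W ≠ 0)
    (h : (P ^ 2 - e ^ 2) * (P ^ 2 - n ^ 2 * e ^ 2) = W ^ 2) : False := by
  obtain ⟨g, A, D, hAD, h1, h2⟩ : ∃ g A D : ℤ, IsCoprime A D ∧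
      P ^ 2 - e ^ 2 = g * A ^ 2 ∧ P ^ 2 - n ^ 2 * e ^ 2 = g * D ^ 2 := by
    have ha0 : P ^ 2 - e ^ 2 ≠ 0 := fun h0 => hW (by simpa [h0] using h.symm)
    have hpos := Int.gcd_pos_of_ne_zero_left (P ^ 2 - n ^ 2 * e ^ 2) ha0
    obtain ⟨a, b, hab, ha, hb⟩ := Int.exists_gcd_one hpos
    set g : ℤ := (Int.gcd (P ^ 2 - e ^ 2) (P ^ 2 - n ^ 2 * e ^ 2) : ℤ) with hg
    have hg0 : g ≠ 0 := by rw [hg]; exact_mod_cast hpos.ne'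
    obtain ⟨V, rfl⟩ : g ∣ W := (Int.pow_dvd_pow_iff two_ne_zero).1
      ⟨a * b, by rw [← h, ha, hb]; ring⟩
    have habV : a * b = V ^ 2 := mul_left_cancel₀ (pow_ne_zero 2 hg0) (by
      rw [ha, hb] at h; linear_combination h)
    have ha0' : a ≠ 0 := fun h0 => ha0 (by rw [ha, h0, zero_mul])
    have hcop := Int.isCoprime_iff_gcd_eq_one.2 hab
    obtain ⟨A, hA⟩ := Int.sq_of_gcd_eq_one hab habV
    have hA0 : A ≠ 0 := by
      rintro rfl
      rcases hA with h0 | h0 <;> exact ha0' (by simpa using h0)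
    have hAV : A ∣ V := (Int.pow_dvd_pow_iff two_ne_zero).1 <| by
      rcases hA with h0 | h0
      · exact ⟨b, by rw [← habV, h0]⟩
      · exact ⟨-b, by rw [← habV, h0]; ring⟩
    obtain ⟨D, rfl⟩ := hAV
    have hco' : ∀ b', b' = D ^ 2 → IsCoprime (A ^ 2) b' → IsCoprime A D := by
      rintro _ rfl h'
      exact (IsCoprime.pow_iff two_pos two_pos).1 h'
    rcases hA with rfl | rfl
    · have hbD : b = D ^ 2 := mul_left_cancel₀ (pow_ne_zero 2 hA0) (by linear_combination habV)
      exact ⟨g, A, D, hco' b hbD hcop, by rw [ha]; ring, by rw [hb, hbD]; ring⟩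
    · have hbD : -b = D ^ 2 := mul_left_cancel₀ (pow_ne_zero 2 hA0) (by linear_combination habV)
      refine ⟨-g, A, D, hco' (-b) hbD ?_, by rw [ha]; ring, by rw [hb, ← hbD]; ring⟩
      simpa using hcop.neg_neg
  have hW' : (g * A * D) ^ 2 = W ^ 2 := by rw [← h, h1, h2]; ring
  have hne : g * A * D ≠ 0 := fun h0 => hW (by simpa [h0] using hW'.symm)
  obtain ⟨e', P', Q', R', he', h3, h4⟩ :=
    exists_smaller_leg (left_ne_zero_of_mul (left_ne_zero_of_mul hne)) h1 h2
      (twist_class hn hco hAD h1 h2)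
  have h0 := descent hn e' P' Q' R' h3 h4
  subst h0
  rcases he' with rfl | rfl | rfl | rfl
  · simp at hne
  · exact hP rfl
  · exact he rfl
  · simp at hne

theorem quartic_rat {n : ℤ} (hn : n = 3 ∨ n = 9) {t w : ℚ}
    (h : (t ^ 2 - 1) * (t ^ 2 - n ^ 2) = w ^ 2) : t = 0 ∨ w = 0 := by
  by_contra! hne
  obtain ⟨ht, hw⟩ := hne
  have hd : (t.den : ℚ) ≠ 0 := by exact_mod_cast t.den_ne_zero
  have hnd : (t.num : ℚ) = t * t.den := by simp
  have hsq : (((t.num ^ 2 - (t.den : ℤ) ^ 2) * (t.num ^ 2 - n ^ 2 * (t.den : ℤ) ^ 2) : ℤ) : ℚ)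
      = (w * t.den ^ 2) ^ 2 := by
    push_cast
    rw [hnd]
    linear_combination (t.den : ℚ) ^ 4 * h
  obtain ⟨W, hW⟩ := Rat.isSquare_intCast_iff.1 ⟨_, hsq.trans (sq _)⟩
  refine quartic_int hn (W := W) (Rat.isCoprime_num_den t) (by simpa using ht)
    (by exact_mod_cast t.den_ne_zero) ?_ (hW.trans (sq W).symm)
  rintro rfl
  rw [hW, mul_zero, Int.cast_zero] at hsq
  exact pow_ne_zero 2 (mul_ne_zero hw (pow_ne_zero 2 hd)) hsq.symm

theorem sq_ne_intCast {m : ℤ} (h : ¬ IsSquare m) (x : ℚ) : x ^ 2 ≠ m := fun hx =>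
  h (Rat.isSquare_intCast_iff.1 ⟨x, by rw [← hx, sq]⟩)

/-- The map `(x, w) ↦ x w / (x² - 25)` is a 2-isogeny onto the curve of `quartic_rat` with `n = 9`. -/
theorem quartic_three_five {x w : ℚ} (h : (x ^ 2 - 9) * (x ^ 2 - 25) = w ^ 2) :
    x = 0 ∨ w = 0 := by
  by_contra! hne
  obtain ⟨hx, hw⟩ := hne
  have h25 : x ^ 2 - 25 ≠ 0 := fun h0 => hw (by simpa [h0] using h.symm)
  have key := quartic_rat (n := 9) (.inr rfl) (t := x * w / (x ^ 2 - 25))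
    (w := (x ^ 2 - 5) * (x ^ 2 - 45) / (x ^ 2 - 25)) (by
      have ht : (x * w / (x ^ 2 - 25)) ^ 2 = x ^ 2 * (x ^ 2 - 9) / (x ^ 2 - 25) := by
        rw [div_pow, mul_pow, ← h]; field_simp
      rw [ht]; push_cast; field_simp; ring)
  have h5 : x ^ 2 - 5 ≠ 0 := sub_ne_zero.2 (by
    exact_mod_cast sq_ne_intCast (m := 5) (by decide +kernel) x)
  have h45 : x ^ 2 - 45 ≠ 0 := sub_ne_zero.2 (by
    exact_mod_cast sq_ne_intCast (m := 45) (by decide +kernel) x)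
  simp [hx, hw, h25, h5, h45] at key

/-- With `x = 2r + 1` the roots `-3, -2, 1, 2` become symmetric, and this is `quartic_three_five`. -/
theorem quartic_neighbours {r w : ℚ} (h : (r ^ 2 - 4) * ((r + 1) ^ 2 - 4) = w ^ 2) :
    r = -1 / 2 ∨ r = 2 ∨ r = -2 ∨ r = 1 ∨ r = -3 := by
  rcases quartic_three_five (x := 2 * r + 1) (w := 4 * w) (by linear_combination 16 * h)
    with h0 | h0
  · left; linarith
  · obtain rfl : w = 0 := by linarith
    have : (r - 2) * ((r + 2) * ((r - 1) * (r + 3))) = 0 := by linear_combination h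
    simp only [mul_eq_zero] at this
    rcases this with h | h | h | h
    · right; left; linarith
    · right; right; left; linarith
    · right; right; right; left; linarith
    · right; right; right; right; linarith

theorem no_rat_neighbours {r a c : ℚ} (ha : a ^ 2 = r ^ 2 - 4) (hc : c ^ 2 = (r + 1) ^ 2 - 4) :
    False := by
  have := quartic_neighbours (r := r) (w := a * c) (by rw [← ha, ← hc]; ring)
  rcases this with rfl | rfl | rfl | rfl | rfl
  · nlinarith [sq_nonneg a]
  · exact sq_ne_intCast (m := 5) (by decide +kernel) c (hc.trans (by norm_num))
  · nlinarith [sq_nonneg c]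
  · nlinarith [sq_nonneg a]
  · exact sq_ne_intCast (m := 5) (by decide +kernel) a (ha.trans (by norm_num))

theorem quartic_outer_neighbours {r w : ℚ} (h : ((r - 1) ^ 2 - 4) * ((r + 1) ^ 2 - 4) = w ^ 2) :
    r = 0 ∨ r = 1 ∨ r = -1 ∨ r = 3 ∨ r = -3 := by
  rcases quartic_rat (n := 3) (.inl rfl) (t := r) (w := w) (by push_cast; linear_combination h)
    with h0 | rfl
  · exact .inl h0
  · have : (r - 1) * ((r + 1) * ((r - 3) * (r + 3))) = 0 := by linear_combination h
    simp only [mul_eq_zero] at this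
    rcases this with h | h | h | h
    · right; left; linarith
    · right; right; left; linarith
    · right; right; right; left; linarith
    · right; right; right; right; linarith

/-! ### Fields of degree at most two -/

section

variable {K : Type*} [Field K] [Algebra ℚ K]

theorem exists_eq_add_mul [FiniteDimensional ℚ K] (hK : Module.finrank ℚ K ≤ 2) {a : K}
    (ha : ∀ q : ℚ, a ≠ algebraMap ℚ K q) (x : K) :
    ∃ p q : ℚ, x = algebraMap ℚ K p + algebraMap ℚ K q * a := by
  have hli : LinearIndependent ℚ ![(1 : K), a] := by
    rw [LinearIndependent.pair_iff' one_ne_zero]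
    intro q hq
    exact ha q (by rw [← hq, Algebra.smul_def, mul_one])
  have hcard : Fintype.card (Fin 2) = Module.finrank ℚ K :=
    le_antisymm hli.fintype_card_le_finrank (by simpa using hK)
  have hx : x ∈ Submodule.span ℚ (Set.range ![(1 : K), a]) := by
    rw [hli.span_eq_top_of_card_eq_finrank' hcard]; trivial
  rw [Matrix.range_cons_cons_empty, Submodule.mem_span_pair] at hx
  obtain ⟨p, q, rfl⟩ := hx
  exact ⟨p, q, by rw [Algebra.smul_def, Algebra.smul_def, mul_one]⟩

theorem eq_zero_of_add_mul_eq_zero {a : K} (ha : ∀ q : ℚ, a ≠ algebraMap ℚ K q) {p q : ℚ}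
    (h : algebraMap ℚ K p + algebraMap ℚ K q * a = 0) : p = 0 ∧ q = 0 := by
  have hq : q = 0 := by
    by_contra hq
    have hq' : algebraMap ℚ K q ≠ 0 := (map_ne_zero _).2 hq
    refine ha (-p / q) ?_
    rw [map_div₀, map_neg, eq_div_iff hq']
    linear_combination h
  subst hq
  exact ⟨(map_eq_zero (algebraMap ℚ K)).1
    (by simpa only [map_zero, zero_mul, add_zero] using h), rfl⟩

theorem rational_or_mul_rational [FiniteDimensional ℚ K] (hK : Module.finrank ℚ K ≤ 2)
    {a b : K} {α β : ℚ} (ha : a ^ 2 = algebraMap ℚ K α) (hb : b ^ 2 = algebraMap ℚ K β) :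
    (∃ q : ℚ, a = algebraMap ℚ K q) ∨ (∃ q : ℚ, b = algebraMap ℚ K q) ∨
      ∃ q : ℚ, a * b = algebraMap ℚ K q := by
  by_cases h : ∃ q : ℚ, a = algebraMap ℚ K q
  · exact .inl h
  push Not at h
  obtain ⟨p, q, rfl⟩ := exists_eq_add_mul hK h b
  have h0 := eq_zero_of_add_mul_eq_zero h (p := p ^ 2 + q ^ 2 * α - β) (q := 2 * p * q) (by
    simp only [map_add, map_sub, map_mul, map_pow, map_ofNat]
    linear_combination hb - (algebraMap ℚ K q) ^ 2 * ha)
  have hpq : p = 0 ∨ q = 0 := by simpa using h0.2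
  rcases hpq with rfl | rfl
  · exact .inr (.inr ⟨q * α, by rw [map_mul, ← ha, map_zero]; ring⟩)
  · exact .inr (.inl ⟨p, by simp⟩)

theorem exists_sq_of_sqrts [FiniteDimensional ℚ K] (hK : Module.finrank ℚ K ≤ 2)
    {a b : K} {α β : ℚ} (ha : a ^ 2 = algebraMap ℚ K α) (hb : b ^ 2 = algebraMap ℚ K β) :
    ∃ q : ℚ, q ^ 2 = α ∨ q ^ 2 = β ∨ q ^ 2 = α * β := by
  have inj := (algebraMap ℚ K).injective
  rcases rational_or_mul_rational hK ha hb with ⟨q, hq⟩ | ⟨q, hq⟩ | ⟨q, hq⟩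
  · exact ⟨q, .inl (inj (by rw [map_pow, ← hq, ha]))⟩
  · exact ⟨q, .inr (.inl (inj (by rw [map_pow, ← hq, hb])))⟩
  · exact ⟨q, .inr (.inr (inj (by rw [map_pow, ← hq, map_mul, ← ha, ← hb]; ring)))⟩

/-! ### Three squares `r² - 4`, `(r - 1)² - 4`, `(r + 1)² - 4` -/

/-- For rational `r`, two of `a, b, c` have a rational product, which leaves the nine values of `r` on
the curves of genus one. For each of them two of the three numbers would need square roots that
generate a biquadratic field. -/
theorem rational_parameter [FiniteDimensional ℚ K] (hK : Module.finrank ℚ K ≤ 2) {r : ℚ}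
    {a b c : K} (ha : a ^ 2 = algebraMap ℚ K (r ^ 2 - 4))
    (hb : b ^ 2 = algebraMap ℚ K ((r - 1) ^ 2 - 4))
    (hc : c ^ 2 = algebraMap ℚ K ((r + 1) ^ 2 - 4)) : False := by
  have inj := (algebraMap ℚ K).injective
  have hmul : ∀ {x y : K} {ξ η : ℚ}, x ^ 2 = algebraMap ℚ K ξ → y ^ 2 = algebraMap ℚ K η →
      (∃ q : ℚ, x * y = algebraMap ℚ K q) → ∃ q, ξ * η = q ^ 2 := by
    rintro x y ξ η hx hy ⟨q, hq⟩
    exact ⟨q, inj (by rw [map_mul, map_pow, ← hq, ← hx, ← hy]; ring)⟩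
  have hpair : ∀ {x y : K}, (∃ q : ℚ, x = algebraMap ℚ K q) → (∃ q : ℚ, y = algebraMap ℚ K q) →
      ∃ q : ℚ, x * y = algebraMap ℚ K q := by
    rintro _ _ ⟨p, rfl⟩ ⟨q, rfl⟩
    exact ⟨p * q, (map_mul _ _ _).symm⟩
  have hr : r = -1 / 2 ∨ r = 1 / 2 ∨ r = 0 ∨ r = 1 ∨ r = -1 ∨ r = 2 ∨ r = -2 ∨ r = 3 ∨ r = -3 := by
    have hprod : (∃ q : ℚ, a * b = algebraMap ℚ K q) ∨ (∃ q : ℚ, a * c = algebraMap ℚ K q) ∨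
        ∃ q : ℚ, b * c = algebraMap ℚ K q := by
      rcases rational_or_mul_rational hK ha hb with h1 | h1 | h1
      · rcases rational_or_mul_rational hK hb hc with h2 | h2 | h2
        exacts [.inl (hpair h1 h2), .inr (.inl (hpair h1 h2)), .inr (.inr h2)]
      · rcases rational_or_mul_rational hK ha hc with h2 | h2 | h2
        exacts [.inl (hpair h2 h1), .inr (.inr (hpair h1 h2)), .inr (.inl h2)]
      · exact .inl h1
    rcases hprod with h | h | h
    · obtain ⟨q, hq⟩ := hmul ha hb h
      rcases quartic_neighbours (r := -r) (w := q) (by linear_combination hq)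
        with h | h | h | h | h
      · have : r = 1 / 2 := by linarith
        simp [this]
      · have : r = -2 := by linarith
        simp [this]
      · have : r = 2 := by linarith
        simp [this]
      · have : r = -1 := by linarith
        simp [this]
      · have : r = 3 := by linarith
        simp [this]
    · obtain ⟨q, hq⟩ := hmul ha hc h
      have := quartic_neighbours hq
      tauto
    · obtain ⟨q, hq⟩ := hmul hb hc h
      have := quartic_outer_neighbours hq
      tauto
  -- multiplying by 4 makes the radicands integral also for `r = ±1/2`
  have hno : ∀ {x y : K} {ξ η : ℚ} (l m k : ℤ), x ^ 2 = algebraMap ℚ K ξ →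
      y ^ 2 = algebraMap ℚ K η → 4 * ξ = l → 4 * η = m → l * m = k →
      ¬ IsSquare l → ¬ IsSquare m → ¬ IsSquare k → False := by
    intro x y ξ η l m k hx hy hl hm hk hsl hsm hsk
    obtain ⟨q, hq | hq | hq⟩ := exists_sq_of_sqrts hK hx hy
    · exact sq_ne_intCast hsl (2 * q) (by rw [mul_pow, hq, ← hl]; norm_num)
    · exact sq_ne_intCast hsm (2 * q) (by rw [mul_pow, hq, ← hm]; norm_num)
    · refine sq_ne_intCast hsk (4 * q) ?_
      rw [mul_pow, hq, ← hk, Int.cast_mul, ← hl, ← hm]; ring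
  rcases hr with rfl | rfl | rfl | rfl | rfl | rfl | rfl | rfl | rfl
  · exact hno (-15) (-7) 105 ha hb (by norm_num) (by norm_num) (by norm_num)
      (by decide +kernel) (by decide +kernel) (by decide +kernel)
  · exact hno (-15) (-7) 105 ha hc (by norm_num) (by norm_num) (by norm_num)
      (by decide +kernel) (by decide +kernel) (by decide +kernel)
  · exact hno (-16) (-12) 192 ha hb (by norm_num) (by norm_num) (by norm_num)
      (by decide +kernel) (by decide +kernel) (by decide +kernel)
  · exact hno (-12) (-16) 192 ha hb (by norm_num) (by norm_num) (by norm_num)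
      (by decide +kernel) (by decide +kernel) (by decide +kernel)
  · exact hno (-12) (-16) 192 ha hc (by norm_num) (by norm_num) (by norm_num)
      (by decide +kernel) (by decide +kernel) (by decide +kernel)
  · exact hno (-12) 20 (-240) hb hc (by norm_num) (by norm_num) (by norm_num)
      (by decide +kernel) (by decide +kernel) (by decide +kernel)
  · exact hno 20 (-12) (-240) hb hc (by norm_num) (by norm_num) (by norm_num)
      (by decide +kernel) (by decide +kernel) (by decide +kernel)
  · exact hno 20 48 960 ha hc (by norm_num) (by norm_num) (by norm_num)
      (by decide +kernel) (by decide +kernel) (by decide +kernel)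
  · exact hno 20 48 960 ha hb (by norm_num) (by norm_num) (by norm_num)
      (by decide +kernel) (by decide +kernel) (by decide +kernel)

/-- For irrational `r`, a point of the curve `a² = r² - 4`, `c² = (r + 1)² - 4` and its conjugate
form a divisor in one of two pencils, on whose members `c - a` or `c + a` is constant. -/
theorem add_or_sub_rational [FiniteDimensional ℚ K] (hK : Module.finrank ℚ K ≤ 2) {r a c : K}
    (hr : ∀ q : ℚ, r ≠ algebraMap ℚ K q) (ha : a ^ 2 = r ^ 2 - 4) (hc : c ^ 2 = (r + 1) ^ 2 - 4) :
    ∃ q : ℚ, c - a = algebraMap ℚ K q ∨ c + a = algebraMap ℚ K q := by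
  have : CharZero K := algebraRat.charZero K
  set φ := algebraMap ℚ K with hφ
  set s := r - a with hs
  have hsr : s * (r + a) = 4 := by rw [hs]; linear_combination -ha
  have hs0 : s ≠ 0 := by
    intro h; rw [h, zero_mul] at hsr; norm_num at hsr
  have hsQ : ∀ q : ℚ, s ≠ φ q := by
    intro q hq
    refine hr ((q + 4 / q) / 2) ?_
    have h4 : r + a = 4 / s := by field_simp; linear_combination hsr
    simp only [map_div₀, map_add, map_ofNat]
    rw [← hq, ← h4, hs]
    ring
  -- the parabola `v = s² + p s + q` through the point and its conjugate, and the minimal polynomial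
  -- `s² - τ s - m` of `s`
  obtain ⟨q, p, hv⟩ := exists_eq_add_mul hK hsQ (2 * s * c - s ^ 2)
  obtain ⟨m, τ, hmin⟩ := exists_eq_add_mul hK hsQ (s ^ 2)
  rw [← hφ] at hv hmin
  have hF : (2 * s * c) ^ 2 = (s ^ 2 + 6 * s + 4) * (s ^ 2 - 2 * s + 4) := by
    have h2 : 2 * s * r = s ^ 2 + 4 := by linear_combination s * hs + hsr
    linear_combination 4 * s ^ 2 * hc + (2 * s * r + s ^ 2 + 4 + 4 * s) * h2
  have hcub : φ (4 - 2 * p) * s ^ 3 + φ (-4 - p ^ 2 - 2 * q) * s ^ 2 + φ (16 - 2 * p * q) * s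
      + φ (16 - q ^ 2) = 0 := by
    have : 2 * s * c = s ^ 2 + φ p * s + φ q := by linear_combination hv
    rw [this] at hF
    simp only [map_sub, map_mul, map_pow, map_neg, map_ofNat]
    linear_combination -hF
  have h2sa : 2 * s * a = 4 - s ^ 2 := by linear_combination (-s) * hs + hsr
  have h2s : (2 * s) ≠ 0 := mul_ne_zero two_ne_zero hs0
  -- for `p = 2` the third intersection point is at infinity
  by_cases hp : 4 - 2 * p = 0
  · obtain rfl : p = 2 := by linarith
    have hq : 4 + q ≠ 0 := by
      intro h
      obtain rfl : q = -4 := by linarith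
      norm_num at hcub
      exact hs0 hcub
    have hq' : φ (4 + q) ≠ 0 := (map_ne_zero φ).2 hq
    refine ⟨1 + (8 - 2 * q) / (4 + q), .inl (mul_left_cancel₀ (mul_ne_zero h2s hq') ?_)⟩
    rw [map_add φ 1, map_div₀, mul_assoc (2 * s) _ (_ + _), mul_add, mul_div_cancel₀ _ hq']
    simp only [map_add, map_sub, map_mul, map_pow, map_neg, map_ofNat, map_one] at hcub hv ⊢
    linear_combination (4 + φ q) * (hv - h2sa) - hcub
  -- otherwise the cubic is `(L s + M) (s² - τ s - m)`, and the third point lies over `s = -M / L`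
  set L := 4 - 2 * p with hL
  set M := -4 - p ^ 2 - 2 * q + τ * L with hM
  have hfac := eq_zero_of_add_mul_eq_zero hsQ (p := 16 - q ^ 2 + M * m)
    (q := L * m + M * τ + (16 - 2 * p * q)) (by
      simp only [hM, map_add, map_sub, map_mul, map_pow, map_neg, map_ofNat] at hcub hmin ⊢
      linear_combination hcub - (φ L * s + (-4 - φ p ^ 2 - 2 * φ q) + φ τ * φ L) * hmin)
  obtain ⟨hf0, hf1⟩ := hfac
  have hM0 : M = 0 := by
    by_contra hM0
    set t := -M / L with ht
    have ht0 : t ≠ 0 := div_ne_zero (neg_ne_zero.2 hM0) hp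
    have hLt : L * t + M = 0 := by rw [ht]; field_simp; ring
    have hFt : (t ^ 2 + 6 * t + 4) * (t ^ 2 - 2 * t + 4) = (t ^ 2 + p * t + q) ^ 2 := by
      have : (L * t + M) * (t ^ 2 - τ * t - m) = 0 := by rw [hLt, zero_mul]
      rw [hM] at this hf0 hf1
      linear_combination this + t * hf1 + hf0
    refine no_rat_neighbours (r := (t + 4 / t) / 2) (a := (4 / t - t) / 2)
      (c := (t ^ 2 + p * t + q) / (2 * t)) (by field_simp; ring) ?_
    rw [div_pow, ← hFt]
    field_simp
    ring
  rw [hM0] at hf0 hf1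
  have hq : (q - 4) * (q + 4) = 0 := by linear_combination -hf0
  rcases mul_eq_zero.1 hq with hq | hq
  -- here `s` has norm 4, so `r + a = 4 / s` is the conjugate of `s = r - a`, and `r` is rational
  · obtain rfl : q = 4 := by linarith
    have hm : m = -4 := by
      have : L * (m + 4) = 0 := by linear_combination hf1 + 4 * hL
      have := (mul_eq_zero.1 this).resolve_left hp
      linarith
    refine absurd ?_ (hr (τ / 2))
    refine mul_left_cancel₀ h2s ?_
    rw [hm] at hmin
    simp only [map_div₀, map_neg, map_ofNat] at hmin ⊢
    linear_combination hmin + s * hs + hsr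
  · obtain rfl : q = -4 := by linarith
    refine ⟨p / 2, .inr (mul_left_cancel₀ h2s ?_)⟩
    simp only [map_div₀, map_neg, map_ofNat] at hv ⊢
    linear_combination hv + h2sa

/-- In a field of degree at most 2 over `ℚ`, the numbers `r² - 4`, `(r - 1)² - 4`, `(r + 1)² - 4` are
never all squares. -/
theorem no_three_square_neighbours [FiniteDimensional ℚ K] (hK : Module.finrank ℚ K ≤ 2)
    {r a b c : K} (ha : a ^ 2 = r ^ 2 - 4) (hb : b ^ 2 = (r - 1) ^ 2 - 4)
    (hc : c ^ 2 = (r + 1) ^ 2 - 4) : False := by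
  have : CharZero K := algebraRat.charZero K
  by_cases hr : ∃ q : ℚ, r = algebraMap ℚ K q
  · obtain ⟨q, rfl⟩ := hr
    exact rational_parameter hK (by simpa using ha) (by simpa using hb) (by simpa using hc)
  push Not at hr
  have hsign : ∀ {r c : K}, (∀ q : ℚ, r ≠ algebraMap ℚ K q) → a ^ 2 = r ^ 2 - 4 →
      c ^ 2 = (r + 1) ^ 2 - 4 → ∃ δ : ℚ, (a + algebraMap ℚ K δ) ^ 2 = (r + 1) ^ 2 - 4 := by
    intro r c hr ha hc
    obtain ⟨δ, h | h⟩ := add_or_sub_rational hK hr ha hc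
    · exact ⟨δ, by rw [← h, ← hc]; ring⟩
    · exact ⟨-δ, by rw [map_neg, ← h, ← hc]; ring⟩
  obtain ⟨δ, hδ⟩ := hsign hr ha hc
  obtain ⟨ε, hε⟩ := hsign (r := -r) (c := b)
    (fun q hq => hr (-q) (by rw [map_neg, ← hq, neg_neg])) (by rw [ha]; ring) (by rw [hb]; ring)
  have haQ : ∀ q : ℚ, a ≠ algebraMap ℚ K q := by
    rintro q rfl
    refine hr ((2 * q * δ + δ ^ 2 - 1) / 2) ?_
    simp only [map_div₀, map_sub, map_add, map_mul, map_pow, map_one, map_ofNat]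
    linear_combination (ha - hδ) / 2
  obtain ⟨h1, h2⟩ := eq_zero_of_add_mul_eq_zero haQ (p := δ ^ 2 + ε ^ 2 - 2) (q := 2 * (δ + ε)) (by
    simp only [map_sub, map_add, map_mul, map_pow, map_ofNat]
    linear_combination hδ + hε - 2 * ha)
  obtain rfl : ε = -δ := by linarith
  have hδ1 : (δ - 1) * (δ + 1) = 0 := by linear_combination h1 / 2
  have h4 : (4 : K) ≠ 0 := by norm_num
  rcases mul_eq_zero.1 hδ1 with h | h
  · obtain rfl : δ = 1 := by linarith
    have har : a = r := by
      simp only [map_one] at hδ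
      linear_combination (hδ - ha) / 2
    rw [har] at ha
    exact h4 (by linear_combination ha)
  · obtain rfl : δ = -1 := by linarith
    have har : a = -r := by
      simp only [map_neg, map_one] at hδ
      linear_combination (ha - hδ) / 2
    rw [har] at ha
    exact h4 (by linear_combination ha)

theorem sq_eq_one_of_curve [FiniteDimensional ℚ K] (hK : Module.finrank ℚ K ≤ 2) {x y z : K}
    (hy : y ^ 2 = (5 * x ^ 2 - 1) * (x ^ 2 + 3)) (hz : z ^ 2 = -(3 * x ^ 2 + 1) * (x ^ 2 - 5)) :
    x ^ 2 = 1 := by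
  by_contra hx
  have hx' : x ^ 2 - 1 ≠ 0 := sub_ne_zero.2 hx
  refine no_three_square_neighbours hK (r := 2 * (x ^ 2 + 1) / (x ^ 2 - 1))
    (a := 4 * x / (x ^ 2 - 1)) (b := z / (x ^ 2 - 1)) (c := y / (x ^ 2 - 1)) ?_ ?_ ?_
  · field_simp; ring
  · rw [div_pow, hz]; field_simp; ring
  · rw [div_pow, hy]; field_simp; ring

end

/-! ### The graph `G₅` and the curve `Y` -/

theorem not_containsCopy_G5 {K : Type*} [Field K] [Algebra ℚ K] [FiniteDimensional ℚ K]
    (hK : Module.finrank ℚ K ≤ 2) (c : K) : ¬ ContainsCopy (preperGraph (quadMap c)) G5 := by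
  rintro ⟨i, hi, hadj⟩
  have hedge : ∀ v w : G5Vertex, v.next = w → (i v : K) ^ 2 + c = (i w : K) :=
    fun v w h => hadj v w h
  have hne : ∀ {v w : G5Vertex}, v ≠ w → (i v : K) - i w ≠ 0 :=
    fun h => sub_ne_zero.2 fun h' => h (hi (Subtype.ext h'))
  have hp₁ := hedge .p₁ .p₁ rfl
  have hp₂ := hedge .p₂ .p₂ rfl
  have hnp₁ := hedge .np₁ .p₁ rfl
  have hnp₂ := hedge .np₂ .p₂ rfl
  have hα₁ := hedge .α₁ .np₁ rfl
  have hα₂ := hedge .α₂ .np₂ rfl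
  have hβ := hedge .β .β' rfl
  have hβ' := hedge .β' .β rfl
  -- distinct points with equal images differ by a sign, and the two fixed points and the points of
  -- the 2-cycle are the roots of `z² - z + c` and `z² + z + c + 1`
  have hsum : (i .p₁ : K) + i .p₂ = 1 :=
    mul_left_cancel₀ (hne (v := .p₁) (w := .p₂) (by simp)) (by linear_combination hp₁ - hp₂)
  have hneg₁ : (i .np₁ : K) = -i .p₁ :=
    mul_left_cancel₀ (hne (v := .np₁) (w := .p₁) (by simp)) (by linear_combination hnp₁ - hp₁)
  have hneg₂ : (i .np₂ : K) = -i .p₂ :=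
    mul_left_cancel₀ (hne (v := .np₂) (w := .p₂) (by simp)) (by linear_combination hnp₂ - hp₂)
  have hcycle : (i .β : K) + i .β' = -1 :=
    mul_left_cancel₀ (hne (v := .β) (w := .β') (by simp)) (by linear_combination hβ - hβ')
  rw [hneg₁] at hα₁
  rw [hneg₂] at hα₂
  refine no_three_square_neighbours hK (r := (i .p₁ : K) - i .p₂) (a := (i .β : K) - i .β')
    (b := 2 * (i .α₁ : K)) (c := 2 * (i .α₂ : K)) ?_ ?_ ?_
  · linear_combination 2 * hβ + 2 * hβ' - 2 * hp₁ - 2 * hp₂ + (3 - (i .β : K) - i .β') * hcycle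
      + (i .p₁ + i .p₂ - 1 : K) * hsum
  · linear_combination 4 * hα₁ - 4 * hp₁ + (3 * i .p₁ - i .p₂ - 3 : K) * hsum
  · linear_combination 4 * hα₂ - 4 * hp₂ - (3 + i .p₁ - 3 * i .p₂ : K) * hsum

/-- Here `K` is a field of degree at most 2 over `ℚ`, embedded in `F`, that contains the coordinates of
`P`. -/
theorem mem_curveY_iff {K F : Type*} [Field K] [Algebra ℚ K] [FiniteDimensional ℚ K] [Field F]
    (hK : Module.finrank ℚ K ≤ 2) (f : K →+* F) {P : Fin 3 → F} (hP : ∀ i, P i ∈ f.range) :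
    P ∈ curveY F ↔ (P 0 = 1 ∨ P 0 = -1) ∧ (P 1 = 4 ∨ P 1 = -4) ∧ (P 2 = 4 ∨ P 2 = -4) := by
  constructor
  · rintro ⟨hy, hz⟩
    obtain ⟨x, hx⟩ := hP 0
    obtain ⟨y, hy'⟩ := hP 1
    obtain ⟨z, hz'⟩ := hP 2
    rw [← hx, ← hy'] at hy
    rw [← hx, ← hz'] at hz
    have h1 : x ^ 2 = 1 := sq_eq_one_of_curve hK (y := y) (z := z)
      (f.injective (by simpa only [map_mul, map_pow, map_add, map_sub, map_one, map_ofNat] using hy))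
      (f.injective (by
        simpa only [map_mul, map_pow, map_add, map_sub, map_neg, map_one, map_ofNat] using hz))
    have hx1 : P 0 ^ 2 = 1 := by rw [← hx, ← map_pow, h1, map_one]
    rw [hx, hy', hx1] at hy
    rw [hx, hz', hx1] at hz
    refine ⟨?_, ?_, ?_⟩ <;> rw [← sq_eq_sq_iff_eq_or_eq_neg]
    · rw [hx1, one_pow]
    · rw [hy]; norm_num
    · rw [hz]; norm_num
  · rintro ⟨h0, h1, h2⟩
    rw [← sq_eq_sq_iff_eq_or_eq_neg] at h0 h1 h2
    refine ⟨?_, ?_⟩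
    · rw [h1, h0]; norm_num
    · rw [h2, h0]; norm_num

end QuadraticDynamics

theorem mainTheorem9 :
    (∀ (K : Type*) [Field K] [NumberField K], Module.finrank ℚ K = 2 → ∀ c : K,
      ¬ QuadraticDynamics.ContainsCopy
        (QuadraticDynamics.preperGraph (QuadraticDynamics.quadMap c)) QuadraticDynamics.G5) ∧
    QuadraticDynamics.ratOrQuadPoints ℚ (QuadraticDynamics.curveY (AlgebraicClosure ℚ)) =
      (fun P : Fin 3 → ℚ => fun i => algebraMap ℚ (AlgebraicClosure ℚ) (P i)) ''
        QuadraticDynamics.curveY ℚ ∧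
    QuadraticDynamics.curveY ℚ =
      {P | (P 0 = 1 ∨ P 0 = -1) ∧ (P 1 = 4 ∨ P 1 = -4) ∧ (P 2 = 4 ∨ P 2 = -4)} ∧
    (QuadraticDynamics.curveY ℚ).ncard = 8 := by

  have hQ : ∀ P : Fin 3 → ℚ, P ∈ QuadraticDynamics.curveY ℚ ↔
      (P 0 = 1 ∨ P 0 = -1) ∧ (P 1 = 4 ∨ P 1 = -4) ∧ (P 2 = 4 ∨ P 2 = -4) := fun P =>
    QuadraticDynamics.mem_curveY_iff (by simp) (RingHom.id ℚ) fun i => ⟨P i, rfl⟩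
  refine ⟨fun K _ _ hK c => QuadraticDynamics.not_containsCopy_G5 hK.le c, ?_, Set.ext hQ, ?_⟩
  · ext P
    constructor
    · rintro ⟨hP, hdeg⟩
      obtain ⟨h0, h1, h2⟩ := (@QuadraticDynamics.mem_curveY_iff _ _ _ _
        (IntermediateField.finiteDimensional_adjoin fun x _ =>
          (AlgebraicClosure.isAlgebraic ℚ).isAlgebraic x |>.isIntegral) _ hdeg
        (IntermediateField.adjoin ℚ (Set.range P)).val.toRingHom P fun i =>
          ⟨⟨P i, IntermediateField.subset_adjoin ℚ _ (Set.mem_range_self i)⟩, rfl⟩).1 hP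
      have hlift : ∀ {x : AlgebraicClosure ℚ} {n : ℚ},
          x = algebraMap ℚ _ n ∨ x = -algebraMap ℚ _ n →
          ∃ q : ℚ, algebraMap ℚ _ q = x ∧ (q = n ∨ q = -n) := by
        rintro x n (rfl | rfl)
        exacts [⟨n, rfl, .inl rfl⟩, ⟨-n, map_neg _ _, .inr rfl⟩]
      obtain ⟨x, hx, hx'⟩ := hlift (n := 1) (by simpa using h0)
      obtain ⟨y, hy, hy'⟩ := hlift (n := 4) (by simpa using h1)
      obtain ⟨z, hz, hz'⟩ := hlift (n := 4) (by simpa using h2)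
      refine ⟨![x, y, z], (hQ _).2 ⟨hx', hy', hz'⟩, ?_⟩
      funext i
      fin_cases i
      exacts [hx, hy, hz]
    · rintro ⟨P, ⟨h1, h2⟩, rfl⟩
      refine ⟨⟨?_, ?_⟩, ?_⟩
      · simpa using congrArg (algebraMap ℚ (AlgebraicClosure ℚ)) h1
      · simpa using congrArg (algebraMap ℚ (AlgebraicClosure ℚ)) h2
      · refine (congrArg (fun L : IntermediateField ℚ (AlgebraicClosure ℚ) => Module.finrank ℚ L)
          (IntermediateField.adjoin_eq_bot_iff.2 ?_)).trans_le
          (IntermediateField.finrank_bot.trans_le one_le_two)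
        rintro _ ⟨i, rfl⟩
        exact ⟨P i, rfl⟩
  -- eight points, as a product of three sets of two elements
  · have : QuadraticDynamics.curveY ℚ =
        (Fintype.piFinset ![({1, -1} : Finset ℚ), {4, -4}, {4, -4}] : Finset (Fin 3 → ℚ)) := by
      ext P
      simp [hQ, Fin.forall_fin_succ]
    rw [this, Set.ncard_coe_finset, Fintype.card_piFinset]
    decide +kernel
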